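/- Let $\mathbb K$ be $\mathbb R$ or $\mathbb C$. For Banach spaces $X_1,\dots,X_N$ over $\mathbb K$ write $\mathbf X=X_1\times\cdots\times X_N$ and let $\mathcal L(^N\mathbf X)$ be the space of continuous $N$-linear forms $\Phi\colon\mathbf X\to\mathbb K$ with the supremum norm over the product of the closed unit balls. A *Banach ideal of $N$-linear forms* $(\mathcal U,\|\cdot\|_{\mathcal U})$ assigns to every $N$-tuple of Banach spaces a linear subspace $\mathcal U(\mathbf X)\subseteq\mathcal L(^N\mathbf X)$ and a complete norm $\|\cdot\|_{\mathcal U}$ on it such that 1. if $\Phi\in\mathcal U(\mathbf X)$ and $T_i\colon Z_i\to X_i$ are bounded linear operators between Banach spaces, then $\Phi\circ(T_1,\dots,T_N)\in\mathcal U(\mathbf Z)$ and $\|\Phi\circ(T_1,\dots,T_N)\|_{\mathcal U}\le\|\Phi\|_{\mathcal U}\|T_1\|\cdots\|T_N\|$; 2. the form $(z_1,\dots,z_N)\mapsto z_1\cdots z_N$ belongs to $\mathcal U(\mathbb K^N)$ and has $\|\cdot\|_{\mathcal U}$-norm one. For $\mathbf j\subseteq\{1,\dots,N\}$ let $P_{\mathbf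 j}\colon\mathbf X\to\mathbf X$ keep the coordinates in $\mathbf j$ and replace the others by $0$. The ideal $\mathcal U$ is *stable at $\mathbf X$* if there is $K>0$ such that for all $\mathbf a\in\mathbf X$, all $\mathbf j\subseteq\{1,\dots,N\}$ and all $\Phi\in\mathcal U(\mathbf X)$ the $N$-linear form $$V_{\mathbf j,\mathbf a}(\Phi)(\mathbf x)=\Phi\bigl(P_{\mathbf j}(\mathbf x)+P_{\mathbf j^c}(\mathbf a)\bigr)\,\Phi\bigl(P_{\mathbf j}(\mathbf a)+P_{\mathbf j^c}(\mathbf x)\bigr)$$ belongs to $\mathcal U(\mathbf X)$ and $\|V_{\mathbf j,\mathbf a}(\Phi)\|_{\mathcal U}\le K\,\|\Phi\|_{\mathcal U}^2\,\|a_1\|\cdots\|a_N\|$. For each permutation $\theta$ of $\{1,\dots,N\}$, the form $\Phi\in\mathcal L(^N\mathbf X)$ has the *Arens extension* $\overline\Phi^{\theta}\colon X_1''\times\cdots\times X_N''\to\mathbb K$, $$\overline\Phi^{\theta}(x_1'',\dots,x_N'')=\lim_{\alpha_{\theta(1)}}\cdots\lim_{\alpha_{\theta(N)}}\Phi(x_{1,\alpha_1},\dots,x_{N,\alpha_N}),$$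 where $(x_{k,\alpha_k})$ is any bounded net in $X_k$ that converges weak-star to $x_k''\in X_k''$. The Arens extensions of $\Phi$ *attain the supremum norm at the same $N$-tuple* if there are $x_k''\in B_{X_k''}$ (closed unit balls), $k=1,\dots,N$, such that for every permutation $\theta$ $$|\overline\Phi^{\theta}(x_1'',\dots,x_N'')|=\sup\bigl\{|\overline\Phi^{\theta}(y_1'',\dots,y_N'')| : y_k''\in B_{X_k''}\bigr\}.$$ **Corollary.** Let $(\mathcal U,\|\cdot\|_{\mathcal U})$ be a Banach ideal of $3$-linear forms and let $\mathbf X=X_1\times X_2\times X_3$ be a product of Banach spaces. Then $\mathcal U$ is stable at $\mathbf X$, and the set of $3$-linear forms in $\mathcal U(\mathbf X)$ all of whose Arens extensions attain the supremum norm at the same triple is $\|\cdot\|_{\mathcal U}$-dense in $\mathcal U(\mathbf X)$. -/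

import Mathlib

open scoped Topology

universe u

/-- A Banach ideal of `N`-linear forms over `𝕜` (`ℝ` or `ℂ`): a class of continuous `N`-linear
forms on Banach spaces together with an ideal norm. Since all the maps are scalar valued, the
operators on the side of the range are multiplications by scalars, which the linear structure
and the homogeneity of the norm take care of. -/
structure BanachIdealOfForms (𝕜 : Type) [RCLike 𝕜] (N : ℕ) where
  /-- The linear subspace `U(X₁ × ⋯ × X_N)` of the continuous `N`-linear forms. -/
  carrier : ∀ (X : Fin N → Type u) [∀ i, NormedAddCommGroup (X i)]
    [∀ i, NormedSpace 𝕜 (X i)] [∀ i, CompleteSpace (X i)],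
    Submodule 𝕜 (ContinuousMultilinearMap 𝕜 X 𝕜)
  /-- The ideal norm `‖·‖_U` on `U(X₁ × ⋯ × X_N)`. -/
  idealNorm : ∀ (X : Fin N → Type u) [∀ i, NormedAddCommGroup (X i)]
    [∀ i, NormedSpace 𝕜 (X i)] [∀ i, CompleteSpace (X i)],
    Seminorm 𝕜 (carrier X)
  /-- The ideal norm separates points, so it is a norm. -/
  eq_zero_of_idealNorm : ∀ (X : Fin N → Type u) [∀ i, NormedAddCommGroup (X i)]
    [∀ i, NormedSpace 𝕜 (X i)] [∀ i, CompleteSpace (X i)] (Φ : carrier X),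
    idealNorm X Φ = 0 → Φ = 0
  /-- `U(X₁ × ⋯ × X_N)` is complete for the ideal norm. -/
  complete : ∀ (X : Fin N → Type u) [∀ i, NormedAddCommGroup (X i)]
    [∀ i, NormedSpace 𝕜 (X i)] [∀ i, CompleteSpace (X i)] (Φ : ℕ → carrier X),
    (∀ ε : ℝ, 0 < ε → ∃ n₀, ∀ m ≥ n₀, ∀ n ≥ n₀, idealNorm X (Φ m - Φ n) < ε) →
      ∃ Ψ : carrier X, Filter.Tendsto (fun n => idealNorm X (Φ n - Ψ)) Filter.atTop (𝓝 0)
  /-- The ideal property: `Φ ∘ (T₁, …, T_N)` belongs to `U`. -/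
  comp_mem : ∀ (X Z : Fin N → Type u) [∀ i, NormedAddCommGroup (X i)]
    [∀ i, NormedSpace 𝕜 (X i)] [∀ i, CompleteSpace (X i)] [∀ i, NormedAddCommGroup (Z i)]
    [∀ i, NormedSpace 𝕜 (Z i)] [∀ i, CompleteSpace (Z i)]
    (T : ∀ i, Z i →L[𝕜] X i) (Φ : carrier X),
    Φ.1.compContinuousLinearMap T ∈ carrier Z
  /-- The ideal property: `‖Φ ∘ (T₁, …, T_N)‖_U ≤ ‖Φ‖_U ‖T₁‖ ⋯ ‖T_N‖`. -/
  idealNorm_comp_le : ∀ (X Z : Fin N → Type u) [∀ i, NormedAddCommGroup (X i)]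
    [∀ i, NormedSpace 𝕜 (X i)] [∀ i, CompleteSpace (X i)] [∀ i, NormedAddCommGroup (Z i)]
    [∀ i, NormedSpace 𝕜 (Z i)] [∀ i, CompleteSpace (Z i)]
    (T : ∀ i, Z i →L[𝕜] X i) (Φ : carrier X),
    idealNorm Z ⟨Φ.1.compContinuousLinearMap T, comp_mem X Z T Φ⟩ ≤
      idealNorm X Φ * ∏ i, ‖T i‖
  /-- `(z₁, …, z_N) ↦ z₁ ⋯ z_N` belongs to `U`; `ULift` puts a copy of the scalar field into the
  universe of the Banach spaces. -/
  prod_mem : (ContinuousMultilinearMap.mkPiAlgebra 𝕜 (Fin N) 𝕜).compContinuousLinearMap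
    (fun _ => (ContinuousLinearEquiv.ulift : ULift.{u} 𝕜 ≃L[𝕜] 𝕜).toContinuousLinearMap) ∈
      carrier (fun _ => ULift.{u} 𝕜)
  /-- `(z₁, …, z_N) ↦ z₁ ⋯ z_N` has ideal norm one. -/
  idealNorm_prod : idealNorm (fun _ => ULift.{u} 𝕜) ⟨_, prod_mem⟩ = 1

section Forms

variable {𝕜 : Type} [RCLike 𝕜] {N : ℕ} {X : Fin N → Type u}
  [∀ i, NormedAddCommGroup (X i)] [∀ i, NormedSpace 𝕜 (X i)]

/-- The `N`-linear form `V_{j,a}(Φ)(x) = Φ(P_j(x) + P_{jᶜ}(a)) Φ(P_j(a) + P_{jᶜ}(x))`, where `P_j`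
keeps the coordinates in `j` and sets the others to zero; `j.piecewise x a` has the coordinates of
`x` at the places in `j` and those of `a` elsewhere, so it is `P_j(x) + P_{jᶜ}(a)`. -/
def mixedProduct (j : Finset (Fin N)) (a : ∀ i, X i) (Φ : ContinuousMultilinearMap 𝕜 X 𝕜) :
    ContinuousMultilinearMap 𝕜 X 𝕜 where
  toFun x := Φ (j.piecewise x a) * Φ (j.piecewise a x)
  map_update_add' := by
    intro inst x i y z
    obtain rfl : inst = instDecidableEqFin N := Subsingleton.elim _ _
    by_cases hi : i ∈ j
    · have h1 : ∀ y, j.piecewise (Function.update x i y) a =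
          Function.update (j.piecewise x a) i y := fun y => by
        rw [j.update_piecewise_of_mem _ _ hi]
      have h2 : ∀ y, j.piecewise a (Function.update x i y) = j.piecewise a x := fun y => by
        ext k; by_cases hk : k ∈ j
        · simp [hk]
        · have : k ≠ i := fun h => hk (h ▸ hi)
          simp [hk, this]
      simp only [h1, h2, Φ.map_update_add, add_mul]
    · have h1 : ∀ y, j.piecewise a (Function.update x i y) =
          Function.update (j.piecewise a x) i y := fun y => by
        rw [j.update_piecewise_of_notMem _ _ hi]
      have h2 : ∀ y, j.piecewise (Function.update x i y) a = j.piecewise x a := fun y => by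
        ext k; by_cases hk : k ∈ j
        · have : k ≠ i := fun h => hi (h ▸ hk)
          simp [hk, this]
        · simp [hk]
      simp only [h1, h2, Φ.map_update_add, mul_add]
  map_update_smul' := by
    intro inst x i c y
    obtain rfl : inst = instDecidableEqFin N := Subsingleton.elim _ _
    by_cases hi : i ∈ j
    · have h1 : ∀ y, j.piecewise (Function.update x i y) a =
          Function.update (j.piecewise x a) i y := fun y => by
        rw [j.update_piecewise_of_mem _ _ hi]
      have h2 : ∀ y, j.piecewise a (Function.update x i y) = j.piecewise a x := fun y => by
        ext k; by_cases hk : k ∈ j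
        · simp [hk]
        · have : k ≠ i := fun h => hk (h ▸ hi)
          simp [hk, this]
      simp only [h1, h2, Φ.map_update_smul, smul_eq_mul, mul_assoc]
    · have h1 : ∀ y, j.piecewise a (Function.update x i y) =
          Function.update (j.piecewise a x) i y := fun y => by
        rw [j.update_piecewise_of_notMem _ _ hi]
      have h2 : ∀ y, j.piecewise (Function.update x i y) a = j.piecewise x a := fun y => by
        ext k; by_cases hk : k ∈ j
        · have : k ≠ i := fun h => hi (h ▸ hk)
          simp [hk, this]
        · simp [hk]
      simp only [h1, h2, Φ.map_update_smul, smul_eq_mul, mul_left_comm]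
  cont := by
    refine (Φ.cont.comp (continuous_pi fun k => ?_)).mul (Φ.cont.comp (continuous_pi fun k => ?_))
    all_goals
      by_cases hk : k ∈ j
      · simpa [hk] using (by fun_prop)
      · simpa [hk] using (by fun_prop)

/-- The permuted form `θΦ : X_{θ(1)} × ⋯ × X_{θ(N)} → 𝕜`, `θΦ(x_{θ(1)}, …, x_{θ(N)}) = Φ(x)`. -/
def permuteForm (θ : Equiv.Perm (Fin N)) (Φ : ContinuousMultilinearMap 𝕜 X 𝕜) :
    ContinuousMultilinearMap 𝕜 (fun i => X (θ i)) 𝕜 where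
  toMultilinearMap := MultilinearMap.domDomCongrLinearEquiv' 𝕜 𝕜 X 𝕜 θ.symm Φ.toMultilinearMap
  cont := Φ.cont.comp (continuous_pi fun k => by
    obtain ⟨i, rfl⟩ := θ.surjective k
    exact (continuous_apply i).congr fun y =>
      (Equiv.piCongrLeft_apply_apply X θ y i).symm)

theorem permuteForm_apply (θ : Equiv.Perm (Fin N)) (Φ : ContinuousMultilinearMap 𝕜 X 𝕜)
    (x : ∀ i, X i) : permuteForm θ Φ (fun i => x (θ i)) = Φ x :=
  congrArg Φ ((Equiv.piCongrLeft X θ).apply_symm_apply x)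

end Forms

section Arens

variable {𝕜 : Type} [RCLike 𝕜]

/-- For fixed `x₁'' ∈ X₁'', …, x_N'' ∈ X_N''`, the functional `Φ ↦ Φ̄(x₁'', …, x_N'')` on the
`N`-linear forms, where `Φ̄(x₁'', …, x_N'') = lim_{α₁} ⋯ lim_{α_N} Φ(x_{1,α₁}, …, x_{N,α_N})` for
nets `x_{k,α_k}` in `X_k` that converge weak-star to `x_k''`. The outermost limit is that of the
functional `x₁ ↦ (Φ(x₁, ·, …, ·))‾(x₂'', …, x_N'')` along `x_{1,α₁}`, which is the value of `x₁''` at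
this functional. -/
noncomputable def arensFunctional : ∀ {n : ℕ} {X : Fin n → Type u}
    [∀ i, NormedAddCommGroup (X i)] [∀ i, NormedSpace 𝕜 (X i)]
    (_ : ∀ i, StrongDual 𝕜 (StrongDual 𝕜 (X i))), ContinuousMultilinearMap 𝕜 X 𝕜 →L[𝕜] 𝕜
  | 0, X, _, _, _ => ContinuousMultilinearMap.apply 𝕜 X 𝕜 0
  | _ + 1, X, _, _, x'' =>
    (x'' 0).comp
      ((ContinuousLinearMap.compL 𝕜 (X 0) _ 𝕜 (arensFunctional fun i => x'' i.succ)).comp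
        (continuousMultilinearCurryLeftEquiv 𝕜 X 𝕜).toContinuousLinearEquiv.toContinuousLinearMap)

/-- The outermost limit: if `x` runs along a filter (a net) that converges weak-star to the first
variable `x₁''`, then `(Φ(x, ·, …, ·))‾(x₂'', …, x_N'')` converges to `Φ̄(x₁'', …, x_N'')`. -/
theorem tendsto_arensFunctional {n : ℕ} {X : Fin (n + 1) → Type u}
    [∀ i, NormedAddCommGroup (X i)] [∀ i, NormedSpace 𝕜 (X i)]
    (x'' : ∀ i, StrongDual 𝕜 (StrongDual 𝕜 (X i))) (Φ : ContinuousMultilinearMap 𝕜 X 𝕜)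
    (F : Filter (X 0)) (hF : ∀ φ : StrongDual 𝕜 (X 0), Filter.Tendsto φ F (𝓝 (x'' 0 φ))) :
    Filter.Tendsto (fun x => arensFunctional (fun i => x'' i.succ) (Φ.curryLeft x)) F
      (𝓝 (arensFunctional x'' Φ)) :=
  hF ((arensFunctional fun i => x'' i.succ).comp Φ.curryLeft)

variable {N : ℕ} {X : Fin N → Type u} [∀ i, NormedAddCommGroup (X i)] [∀ i, NormedSpace 𝕜 (X i)]

/-- The Arens extension `X₁'' × ⋯ × X_N'' → 𝕜` of `Φ` that belongs to the order `θ` of the variables: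
`lim_{α_{θ(1)}} ⋯ lim_{α_{θ(N)}} Φ(x_{1,α₁}, …, x_{N,α_N})`. -/
noncomputable def arensExtension (θ : Equiv.Perm (Fin N)) (Φ : ContinuousMultilinearMap 𝕜 X 𝕜)
    (x'' : ∀ i, StrongDual 𝕜 (StrongDual 𝕜 (X i))) : 𝕜 :=
  arensFunctional (fun i => x'' (θ i)) (permuteForm θ Φ)

/-- All the `N!` Arens extensions of `Φ` attain their supremum norm, the supremum of the absolute
value over the product of the closed unit balls of the biduals, at the same `N`-tuple. -/
def ArensExtensionsAttainNormTogether (Φ : ContinuousMultilinearMap 𝕜 X 𝕜) : Prop :=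
  ∃ x'' : ∀ i, StrongDual 𝕜 (StrongDual 𝕜 (X i)), (∀ i, ‖x'' i‖ ≤ 1) ∧
    ∀ θ : Equiv.Perm (Fin N),
      IsMaxOn (fun y'' => ‖arensExtension θ Φ y''‖) {y'' | ∀ i, ‖y'' i‖ ≤ 1} x''

end Arens

/-- Stability of an ideal of `N`-linear forms at `X₁ × ⋯ × X_N`. -/
def BanachIdealOfForms.StableAt {𝕜 : Type} [RCLike 𝕜] {N : ℕ} (U : BanachIdealOfForms.{u} 𝕜 N)
    (X : Fin N → Type u) [∀ i, NormedAddCommGroup (X i)] [∀ i, NormedSpace 𝕜 (X i)]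
    [∀ i, CompleteSpace (X i)] : Prop :=
  ∃ K : ℝ, 0 < K ∧ ∀ (a : ∀ i, X i) (j : Finset (Fin N)) (Φ : U.carrier X),
    ∃ h : mixedProduct j a Φ.1 ∈ U.carrier X,
      U.idealNorm X ⟨mixedProduct j a Φ.1, h⟩ ≤ K * U.idealNorm X Φ ^ 2 * ∏ i, ‖a i‖

/-! ### Mixed products and norm estimates for multilinear forms. -/

section Forms

variable {𝕜 : Type} [RCLike 𝕜] {N : ℕ} {X : Fin N → Type u}
  [∀ i, NormedAddCommGroup (X i)] [∀ i, NormedSpace 𝕜 (X i)]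

/-! Stability: `mixedProduct` does not change when `j` is replaced by its complement, and among
three places `j` or `jᶜ` has at most one element. For such a set the mixed product is a scalar
multiple of Φ or Φ composed with a rank-one operator in one place, so the ideal property bounds it,
with K = 1.

Density holds for every stable ideal, by Lindenstrauss' iteration. Choose a_n almost norming Φ_n and
add to Φ_n a multiple ε_n c of the sum of all V_{j,a_n}(Φ_n), with c a phase. At a_n all M = 2^N
summands align, which gains about M ε_n ‖Φ_n‖². A point x almost norming Φ_{n+1} must gain nearly as
much, so every |Φ_n(P_j x + P_{jᶜ} a_n)| is close to ‖Φ_n‖ (`mixed_term_lower_bound`). Iterating,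
points whose coordinates come from different late a_m almost norm the limit Ψ
(`norm_sub_le_norm_apply_mixed`). The estimate is uniform in the indices, hence survives iterated
limits in any order: the weak-star limit of (a_n) along one ultrafilter norms all Arens extensions.
-/

theorem mixedProduct_apply (j : Finset (Fin N)) (a x : ∀ i, X i)
    (Φ : ContinuousMultilinearMap 𝕜 X 𝕜) :
    mixedProduct j a Φ x = Φ (j.piecewise x a) * Φ (j.piecewise a x) :=
  rfl

theorem mixedProduct_compl (j : Finset (Fin N)) (a : ∀ i, X i)
    (Φ : ContinuousMultilinearMap 𝕜 X 𝕜) : mixedProduct jᶜ a Φ = mixedProduct j a Φ := by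
  ext x
  simp only [mixedProduct_apply, Finset.piecewise_compl, mul_comm]

theorem mixedProduct_empty (a : ∀ i, X i) (Φ : ContinuousMultilinearMap 𝕜 X 𝕜) :
    mixedProduct ∅ a Φ = Φ a • Φ := by
  ext x
  simp [mixedProduct_apply]

/-- The rank-one operator `x ↦ Φ(a₁, …, x, …, a_N) a_i` in the `i`-th place, the identity in the
other places. -/
noncomputable def singletonOperator (i : Fin N) (a : ∀ i, X i)
    (Φ : ContinuousMultilinearMap 𝕜 X 𝕜) : ∀ k, X k →L[𝕜] X k :=
  Function.update (fun k => ContinuousLinearMap.id 𝕜 (X k)) i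
    ((Φ.toContinuousLinearMap a i).smulRight (a i))

/-- One factor of the mixed product depends on x_i alone, the other does not involve x_i and has a_i
in place i; by linearity the first factor moves into that place as a scalar. -/
theorem mixedProduct_singleton (i : Fin N) (a : ∀ i, X i)
    (Φ : ContinuousMultilinearMap 𝕜 X 𝕜) :
    mixedProduct {i} a Φ = Φ.compContinuousLinearMap (singletonOperator i a Φ) := by
  ext x
  have h : (fun k => singletonOperator i a Φ k (x k)) =
      Function.update x i (Φ (Function.update a i (x i)) • a i) := by
    ext k
    by_cases hk : k = i
    · subst hk; simp [singletonOperator]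
    · simp [singletonOperator, hk]
  rw [ContinuousMultilinearMap.compContinuousLinearMap_apply, h, Φ.map_update_smul,
    mixedProduct_apply, Finset.piecewise_singleton, Finset.piecewise_singleton, smul_eq_mul]

theorem prod_norm_singletonOperator_le (i : Fin N) (a : ∀ i, X i)
    (Φ : ContinuousMultilinearMap 𝕜 X 𝕜) :
    ∏ k, ‖singletonOperator i a Φ k‖ ≤ ‖Φ‖ * ∏ k, ‖a k‖ := by
  rw [← Finset.mul_prod_erase _ _ (Finset.mem_univ i)]
  have h1 : ∏ k ∈ Finset.univ.erase i, ‖singletonOperator i a Φ k‖ ≤ 1 := by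
    refine Finset.prod_le_one (fun _ _ => norm_nonneg _) fun k hk => ?_
    simpa [singletonOperator, Finset.ne_of_mem_erase hk] using ContinuousLinearMap.norm_id_le
  have h2 : ‖singletonOperator i a Φ i‖ ≤ ‖Φ‖ * ∏ k, ‖a k‖ := by
    refine ContinuousLinearMap.opNorm_le_bound _ (by positivity) fun x => ?_
    have h := Φ.le_opNorm (Function.update a i x)
    rw [← Finset.mul_prod_erase _ _ (Finset.mem_univ i), Function.update_self,
      Finset.prod_congr rfl fun k hk => by
        rw [Function.update_of_ne (Finset.ne_of_mem_erase hk)]] at h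
    rw [← Finset.mul_prod_erase Finset.univ (fun k => ‖a k‖) (Finset.mem_univ i)]
    simp only [singletonOperator, Function.update_self, ContinuousLinearMap.smulRight_apply,
      norm_smul, ContinuousMultilinearMap.toContinuousLinearMap_apply]
    calc _ ≤ _ := mul_le_mul_of_nonneg_right h (norm_nonneg (a i))
      _ = _ := by ring
  calc _ ≤ ‖singletonOperator i a Φ i‖ * 1 := mul_le_mul_of_nonneg_left h1 (norm_nonneg _)
    _ ≤ _ := by rwa [mul_one]

theorem norm_permuteForm_le (θ : Equiv.Perm (Fin N)) (Φ : ContinuousMultilinearMap 𝕜 X 𝕜) :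
    ‖permuteForm θ Φ‖ ≤ ‖Φ‖ := by
  refine ContinuousMultilinearMap.opNorm_le_bound (norm_nonneg _) fun y => ?_
  obtain ⟨x, rfl⟩ : ∃ x : ∀ i, X i, y = fun i => x (θ i) :=
    ⟨Equiv.piCongrLeft X θ y, funext fun i => (Equiv.piCongrLeft_apply_apply X θ y i).symm⟩
  rw [permuteForm_apply, Equiv.prod_comp θ fun i => ‖x i‖]
  exact Φ.le_opNorm x

theorem ContinuousMultilinearMap.norm_apply_le_norm (Φ : ContinuousMultilinearMap 𝕜 X 𝕜)
    {x : ∀ i, X i} (hx : ∀ i, ‖x i‖ ≤ 1) : ‖Φ x‖ ≤ ‖Φ‖ :=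
  (Φ.le_opNorm x).trans
    (mul_le_of_le_one_right (norm_nonneg _) (Finset.prod_le_one (fun _ _ => norm_nonneg _)
      fun i _ => hx i))

theorem ContinuousMultilinearMap.exists_norm_sub_le (Φ : ContinuousMultilinearMap 𝕜 X 𝕜)
    {η : ℝ} (hη : 0 < η) : ∃ a : ∀ i, X i, (∀ i, ‖a i‖ ≤ 1) ∧ ‖Φ‖ - η ≤ ‖Φ a‖ := by
  by_contra! h
  have h0 : 0 ≤ ‖Φ‖ - η := (norm_nonneg _).trans (h 0 (by simp)).le
  have : ‖Φ‖ ≤ ‖Φ‖ - η := by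
    refine ContinuousMultilinearMap.opNorm_le_bound h0 fun x => ?_
    -- Normalising each coordinate is harmless even when x_i = 0, since then both sides vanish.
    have hx : x = fun i => ((‖x i‖ : ℝ) : 𝕜) • (((‖x i‖ : ℝ) : 𝕜)⁻¹ • x i) := by
      ext i
      by_cases hi : x i = 0
      · simp [hi]
      · rw [smul_inv_smul₀]; simpa using hi
    have hn : ‖Φ x‖ = (∏ i, ‖x i‖) * ‖Φ fun i => ((‖x i‖ : ℝ) : 𝕜)⁻¹ • x i‖ := by
      conv_lhs => rw [hx, Φ.map_smul_univ]
      simp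
    rw [hn, mul_comm]
    refine mul_le_mul_of_nonneg_right (h _ fun i => ?_).le (by positivity)
    rw [norm_smul, norm_inv, RCLike.norm_ofReal, abs_norm]
    exact inv_mul_le_one
  linarith

end Forms

/-! ### Arens extensions and iterated weak-star limits. -/

section Arens

variable {𝕜 : Type} [RCLike 𝕜]

theorem norm_arensFunctional_le : ∀ {n : ℕ} {X : Fin n → Type u}
    [∀ i, NormedAddCommGroup (X i)] [∀ i, NormedSpace 𝕜 (X i)]
    (x'' : ∀ i, StrongDual 𝕜 (StrongDual 𝕜 (X i))) (_ : ∀ i, ‖x'' i‖ ≤ 1)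
    (Φ : ContinuousMultilinearMap 𝕜 X 𝕜), ‖arensFunctional x'' Φ‖ ≤ ‖Φ‖
  | 0, X, _, _, x'', _, Φ => Φ.norm_apply_le_norm (by simp)
  | n + 1, X, _, _, x'', hx, Φ => by
    have h : ‖(arensFunctional fun i => x'' i.succ).comp Φ.curryLeft‖ ≤ ‖Φ‖ := by
      refine ContinuousLinearMap.opNorm_le_bound _ (norm_nonneg _) fun x => ?_
      refine (norm_arensFunctional_le _ (fun i => hx i.succ) _).trans ?_
      simpa using Φ.curryLeft.le_opNorm x
    calc ‖arensFunctional x'' Φ‖ ≤ ‖x'' 0‖ * _ :=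
          (x'' 0).le_opNorm ((arensFunctional fun i => x'' i.succ).comp Φ.curryLeft)
      _ ≤ 1 * ‖Φ‖ := mul_le_mul (hx 0) h (norm_nonneg _) zero_le_one
      _ = _ := one_mul _

/-- The lower bound holds for all independent choices of indices in S, so each of the n limits can
be taken in turn, the inner ones with the outer indices fixed in S. -/
theorem le_norm_arensFunctional {ι : Type*} (F : Filter ι) [F.NeBot] {S : Set ι} (hS : S ∈ F)
    (r : ℝ) : ∀ {n : ℕ} {X : Fin n → Type u}
    [∀ i, NormedAddCommGroup (X i)] [∀ i, NormedSpace 𝕜 (X i)]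
    (a : ι → ∀ i, X i) (x'' : ∀ i, StrongDual 𝕜 (StrongDual 𝕜 (X i)))
    (_ : ∀ i (φ : StrongDual 𝕜 (X i)), Filter.Tendsto (fun m => φ (a m i)) F (𝓝 (x'' i φ)))
    (Φ : ContinuousMultilinearMap 𝕜 X 𝕜)
    (_ : ∀ m : Fin n → ι, (∀ i, m i ∈ S) → r ≤ ‖Φ fun i => a (m i) i‖),
    r ≤ ‖arensFunctional x'' Φ‖
  | 0, X, _, _, a, x'', _, Φ, h => by
    have h0 := h Fin.elim0 (fun i => i.elim0)
    rwa [Subsingleton.elim (fun i => a (Fin.elim0 i) i) 0] at h0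
  | n + 1, X, _, _, a, x'', ha, Φ, h => by
    have ht := (tendsto_arensFunctional x'' Φ (F.map fun m => a m 0)
      fun φ => Filter.tendsto_map'_iff.2 (ha 0 φ)).norm
    rw [Filter.tendsto_map'_iff] at ht
    refine ge_of_tendsto ht (Filter.mem_of_superset hS fun m₀ hm₀ => ?_)
    refine le_norm_arensFunctional F hS r (fun m i => a m i.succ) _ (fun i => ha i.succ) _
      fun m hm => ?_
    have h1 := h (Fin.cons m₀ m) (Fin.cases hm₀ hm)
    have h2 : (fun i => a ((Fin.cons m₀ m : Fin (n + 1) → ι) i) i) =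
        Fin.cons (a m₀ 0) fun i => a (m i) i.succ := by
      ext i; refine Fin.cases ?_ (fun i => ?_) i <;> simp
    rw [h2] at h1
    exact h1

/-- Banach–Alaoglu in the bidual; an ultrafilter makes the whole family converge, so all coordinates
share one filter. -/
theorem exists_bidual_limit {E : Type*} [NormedAddCommGroup E] [NormedSpace 𝕜 E] {ι : Type*}
    (F : Ultrafilter ι) (a : ι → E) (ha : ∀ m, ‖a m‖ ≤ 1) :
    ∃ x'' : StrongDual 𝕜 (StrongDual 𝕜 E), ‖x''‖ ≤ 1 ∧
      ∀ φ : StrongDual 𝕜 E, Filter.Tendsto (fun m => φ (a m)) F (𝓝 (x'' φ)) := by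
  let J : ι → WeakDual 𝕜 (StrongDual 𝕜 E) := fun m =>
    StrongDual.toWeakDual (NormedSpace.inclusionInDoubleDual 𝕜 E (a m))
  have hc := WeakDual.isCompact_closedBall (𝕜 := 𝕜) (0 : StrongDual 𝕜 (StrongDual 𝕜 E)) 1
  obtain ⟨x, hx, hle⟩ := hc.ultrafilter_le_nhds (F.map J) (by
    rw [Ultrafilter.coe_map, Filter.le_principal_iff, Filter.mem_map]
    refine Filter.univ_mem' fun m => ?_
    simp only [Set.mem_preimage, Metric.mem_closedBall, dist_zero_right]
    exact (NormedSpace.double_dual_bound 𝕜 E (a m)).trans (ha m))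
  refine ⟨WeakDual.toStrongDual x, by simpa using hx, fun φ => ?_⟩
  exact ((WeakDual.eval_continuous φ).tendsto x).comp (show Filter.Tendsto J F (𝓝 x) from hle)

variable {N : ℕ} {X : Fin N → Type u} [∀ i, NormedAddCommGroup (X i)] [∀ i, NormedSpace 𝕜 (X i)]

theorem norm_arensExtension_le (θ : Equiv.Perm (Fin N)) (Φ : ContinuousMultilinearMap 𝕜 X 𝕜)
    {x'' : ∀ i, StrongDual 𝕜 (StrongDual 𝕜 (X i))} (hx : ∀ i, ‖x'' i‖ ≤ 1) :
    ‖arensExtension θ Φ x''‖ ≤ ‖Φ‖ :=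
  (norm_arensFunctional_le _ (fun i => hx (θ i)) _).trans (norm_permuteForm_le θ Φ)

/-- If a sequence in the product of the unit balls almost norms `Φ`, uniformly over all ways of
picking the coordinates from different late members, then the Arens extensions of `Φ` attain their
norms at the same point. -/
theorem arensExtensionsAttainNormTogether_of_sequence (Φ : ContinuousMultilinearMap 𝕜 X 𝕜)
    (a : ℕ → ∀ i, X i) (ha : ∀ n i, ‖a n i‖ ≤ 1)
    (h : ∀ δ > 0, ∃ n : ℕ, ∀ m : Fin N → ℕ, (∀ i, n ≤ m i) → ‖Φ‖ - δ ≤ ‖Φ fun i => a (m i) i‖) :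
    ArensExtensionsAttainNormTogether Φ := by
  choose x'' hx hlim using fun i => exists_bidual_limit (𝕜 := 𝕜) (Filter.hyperfilter ℕ)
    (fun n => a n i) fun n => ha n i
  -- `x''` is fixed before θ. No Arens extension exceeds ‖Φ‖ on the balls, so reaching ‖Φ‖ at `x''`
  -- suffices.
  refine ⟨x'', hx, fun θ y'' hy => (norm_arensExtension_le θ Φ hy).trans ?_⟩
  refine le_of_forall_sub_le fun δ hδ => ?_
  obtain ⟨n, hn⟩ := h δ hδ
  refine le_norm_arensFunctional (Filter.hyperfilter ℕ : Filter ℕ) (S := Set.Ici n)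
    (Nat.hyperfilter_le_atTop (Filter.Ici_mem_atTop n)) _ (fun m i => a m (θ i)) _
    (fun i => hlim (θ i)) _ fun m hm => ?_
  have h1 := hn (fun i => m (θ.symm i)) fun i => hm _
  rw [← permuteForm_apply θ Φ] at h1
  simpa using h1

end Arens

/-! ### Stability of ideals of trilinear forms. -/

namespace BanachIdealOfForms

variable {𝕜 : Type} [RCLike 𝕜] {N : ℕ} (U : BanachIdealOfForms.{u} 𝕜 N)
  {X : Fin N → Type u} [∀ i, NormedAddCommGroup (X i)] [∀ i, NormedSpace 𝕜 (X i)]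
  [∀ i, CompleteSpace (X i)]

/-- Composing Φ with the operators z ↦ z x_i gives Φ(x) times the product form, which has ideal norm
one. -/
theorem norm_le_idealNorm (Φ : U.carrier X) : ‖Φ.1‖ ≤ U.idealNorm X Φ := by
  refine ContinuousMultilinearMap.opNorm_le_bound (apply_nonneg _ _) fun x => ?_
  let e : ULift.{u} 𝕜 →L[𝕜] 𝕜 :=
    (ContinuousLinearEquiv.ulift : ULift.{u} 𝕜 ≃L[𝕜] 𝕜).toContinuousLinearMap
  let T : ∀ i, ULift.{u} 𝕜 →L[𝕜] X i := fun i => e.smulRight (x i)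
  have hT : ∀ i, ‖T i‖ ≤ ‖x i‖ := fun i =>
    ContinuousLinearMap.opNorm_le_bound _ (norm_nonneg _) fun z => by
      rw [ContinuousLinearMap.smulRight_apply, norm_smul, mul_comm]; rfl
  have hcomp : (⟨_, U.comp_mem X (fun _ => ULift.{u} 𝕜) T Φ⟩ : U.carrier fun _ => ULift.{u} 𝕜) =
      Φ.1 x • ⟨_, U.prod_mem⟩ := by
    ext z
    change Φ.1 (fun i => (z i).down • x i) =
      Φ.1 x * ContinuousMultilinearMap.mkPiAlgebra 𝕜 (Fin N) 𝕜 fun i => (z i).down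
    rw [Φ.1.map_smul_univ, smul_eq_mul, mul_comm, ContinuousMultilinearMap.mkPiAlgebra_apply]
  have h := U.idealNorm_comp_le X (fun _ => ULift.{u} 𝕜) T Φ
  rw [hcomp, map_smul_eq_mul, U.idealNorm_prod, mul_one] at h
  exact h.trans (mul_le_mul_of_nonneg_left
    (Finset.prod_le_prod (fun _ _ => norm_nonneg _) fun i _ => hT i) (apply_nonneg _ _))

theorem mixedProduct_bound_of_card_le_one (a : ∀ i, X i) (j : Finset (Fin N)) (hj : j.card ≤ 1)
    (Φ : U.carrier X) : ∃ h : mixedProduct j a Φ.1 ∈ U.carrier X,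
      U.idealNorm X ⟨mixedProduct j a Φ.1, h⟩ ≤ U.idealNorm X Φ ^ 2 * ∏ i, ‖a i‖ := by
  have hp : 0 ≤ ∏ i, ‖a i‖ := by positivity
  have hΦ : 0 ≤ U.idealNorm X Φ := apply_nonneg _ _
  have hn := U.norm_le_idealNorm Φ
  obtain rfl | ⟨i, rfl⟩ : j = ∅ ∨ ∃ i, j = {i} := by
    rwa [Nat.le_one_iff_eq_zero_or_eq_one, Finset.card_eq_zero, Finset.card_eq_one] at hj
  · rw [mixedProduct_empty]
    refine ⟨(Φ.1 a • Φ).2, ?_⟩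
    change U.idealNorm X (Φ.1 a • Φ) ≤ _
    rw [map_smul_eq_mul]
    calc _ ≤ (U.idealNorm X Φ * ∏ i, ‖a i‖) * U.idealNorm X Φ :=
          mul_le_mul_of_nonneg_right ((Φ.1.le_opNorm a).trans
            (mul_le_mul_of_nonneg_right hn hp)) hΦ
      _ = _ := by ring
  · rw [mixedProduct_singleton]
    refine ⟨U.comp_mem X X _ Φ, (U.idealNorm_comp_le X X _ Φ).trans ?_⟩
    calc _ ≤ U.idealNorm X Φ * (U.idealNorm X Φ * ∏ i, ‖a i‖) :=
          mul_le_mul_of_nonneg_left ((prod_norm_singletonOperator_le i a Φ.1).trans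
            (mul_le_mul_of_nonneg_right hn hp)) hΦ
      _ = _ := by ring

theorem stableAt_three (U : BanachIdealOfForms.{u} 𝕜 3) (X : Fin 3 → Type u)
    [∀ i, NormedAddCommGroup (X i)] [∀ i, NormedSpace 𝕜 (X i)] [∀ i, CompleteSpace (X i)] :
    U.StableAt X := by
  refine ⟨1, one_pos, fun a j Φ => ?_⟩
  rw [one_mul]
  rcases le_or_gt j.card 1 with hj | hj
  · exact U.mixedProduct_bound_of_card_le_one a j hj Φ
  · rw [← mixedProduct_compl]
    exact U.mixedProduct_bound_of_card_le_one a jᶜ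
      (by rw [Finset.card_compl, Fintype.card_fin]; omega) Φ

end BanachIdealOfForms

/-! ### Parameters and an elementary inequality for the iteration. -/

theorem exists_cubic_sequence {t : ℝ} (ht : 0 < t) (ht' : t ≤ 1 / 2) :
    ∃ ε : ℕ → ℝ, ε 0 = t ∧ ∀ n, 0 < ε n ∧ ε n ≤ t ∧ ε (n + 1) = ε n ^ 3 ∧
      ε (n + 1) ≤ ε n / 2 := by
  have hpos : ∀ n : ℕ, 0 < t ^ 3 ^ n := fun n => by positivity
  have hle : ∀ n : ℕ, t ^ 3 ^ n ≤ t := fun n =>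
    pow_le_of_le_one ht.le (by linarith) (by positivity)
  refine ⟨fun n => t ^ 3 ^ n, by simp, fun n => ⟨hpos n, hle n, by simp only [pow_succ 3, pow_mul], ?_⟩⟩
  simp only [pow_succ 3, pow_mul]
  have h1 := hpos n
  have h2 := (hle n).trans ht'
  generalize t ^ 3 ^ n = s at *
  nlinarith [mul_pos h1 h1]

/-- If all the `M` products `α β ≤ s²` together contribute at least `M (s - η)² - (η + τ) / ε`, each
factor `α` has to be close to `s`. -/
theorem mixed_term_lower_bound {ι : Type*} {S : Finset ι} {α β : ι → ℝ} {s v η τ ε : ℝ}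
    (hα : ∀ j, 0 ≤ α j) (hαs : ∀ j, α j ≤ s) (hβ : ∀ j, 0 ≤ β j) (hβs : ∀ j, β j ≤ s)
    (hv0 : 0 ≤ v) (hv : s - η ≤ v) (hvs : v ≤ s) (hε : 0 ≤ ε)
    (h : v + S.card * ε * v ^ 2 - τ ≤ s + ε * ∑ j ∈ S, α j * β j) {j : ι} (hj : j ∈ S) :
    ε * s * (s - α j) ≤ 2 * S.card * ε * s * η + η + τ := by
  classical
  have hs : 0 ≤ s := hv0.trans hvs
  -- Bounding every other term by s² charges the whole deficit to the term j.
  have h1 : ∑ j ∈ S, α j * β j ≤ S.card * s ^ 2 - s ^ 2 + α j * s := by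
    rw [← Finset.add_sum_erase _ _ hj]
    have h2 : ∑ k ∈ S.erase j, α k * β k ≤ ∑ k ∈ S.erase j, s ^ 2 :=
      Finset.sum_le_sum fun k _ => by
        rw [sq]; exact mul_le_mul (hαs k) (hβs k) (hβ k) hs
    rw [Finset.sum_const, nsmul_eq_mul, Finset.card_erase_of_mem hj,
      Nat.cast_sub (Finset.card_pos.2 ⟨j, hj⟩), Nat.cast_one] at h2
    nlinarith [mul_le_mul_of_nonneg_left (hβs j) (hα j)]
  have h3 : s ^ 2 - v ^ 2 ≤ 2 * s * η := by nlinarith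
  have h4 := mul_le_mul_of_nonneg_left h1 hε
  have h5 := mul_le_mul_of_nonneg_left h3 (mul_nonneg (Nat.cast_nonneg S.card) hε)
  nlinarith

/-! ### Lindenstrauss' iteration in a stable ideal. -/

namespace BanachIdealOfForms

variable {𝕜 : Type} [RCLike 𝕜] {N : ℕ} {U : BanachIdealOfForms.{u} 𝕜 N}
  {X : Fin N → Type u} [∀ i, NormedAddCommGroup (X i)] [∀ i, NormedSpace 𝕜 (X i)]
  [∀ i, CompleteSpace (X i)]

/-- One step of Lindenstrauss' perturbation. -/
theorem exists_perturbation {K : ℝ} (hK : 0 < K)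
    (hU : ∀ (a : ∀ i, X i) (j : Finset (Fin N)) (Φ : U.carrier X),
      ∃ h : mixedProduct j a Φ.1 ∈ U.carrier X,
        U.idealNorm X ⟨mixedProduct j a Φ.1, h⟩ ≤ K * U.idealNorm X Φ ^ 2 * ∏ i, ‖a i‖)
    (Φ : U.carrier X) {ε η : ℝ} (hε : 0 ≤ ε) (hη : 0 < η) :
    ∃ (a : ∀ i, X i) (Ψ : U.carrier X), (∀ i, ‖a i‖ ≤ 1) ∧ ‖Φ.1‖ - η ≤ ‖Φ.1 a‖ ∧
      U.idealNorm X (Ψ - Φ) ≤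
        ε * (Fintype.card (Finset (Fin N)) * K * U.idealNorm X Φ ^ 2) ∧
      ‖Φ.1 a‖ + Fintype.card (Finset (Fin N)) * ε * ‖Φ.1 a‖ ^ 2 ≤ ‖Ψ.1‖ ∧
      ∀ x, ‖Ψ.1 x‖ ≤ ‖Φ.1 x‖ + ε * ∑ j : Finset (Fin N),
        ‖Φ.1 (j.piecewise x a)‖ * ‖Φ.1 (j.piecewise a x)‖ := by
  obtain ⟨a, ha, hΦa⟩ := Φ.1.exists_norm_sub_le hη
  choose h hV using hU
  -- Every mixed product takes the value Φ(a)² at a; the factor c turns it into |Φ(a)| Φ(a), aligned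
  -- with Φ(a).
  obtain ⟨c, hc, hcΦ⟩ : ∃ c : 𝕜, ‖c‖ ≤ 1 ∧ c * Φ.1 a = ((‖Φ.1 a‖ : ℝ) : 𝕜) := by
    by_cases h0 : Φ.1 a = 0
    · exact ⟨0, by simp, by simp [h0]⟩
    · have h1 : ((‖Φ.1 a‖ : ℝ) : 𝕜) ≠ 0 := by simpa using h0
      refine ⟨((‖Φ.1 a‖ : ℝ) : 𝕜) / Φ.1 a, ?_, div_mul_cancel₀ _ h0⟩
      rw [norm_div, RCLike.norm_ofReal, abs_norm]
      exact div_self_le_one _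
  let V : U.carrier X := ∑ j : Finset (Fin N), ⟨mixedProduct j a Φ.1, h a j Φ⟩
  have hVx : ∀ x, V.1 x = ∑ j : Finset (Fin N),
      Φ.1 (j.piecewise x a) * Φ.1 (j.piecewise a x) := fun x => by
    simp only [V, AddSubmonoidClass.coe_finsetSum, sum_apply,
      mixedProduct_apply]
  let Ψ : U.carrier X := Φ + ((ε : 𝕜) * c) • V
  have hΨx : ∀ x, Ψ.1 x = Φ.1 x + ((ε : 𝕜) * c) * V.1 x := fun x => rfl
  have hεc : ‖(ε : 𝕜) * c‖ ≤ ε := by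
    rw [norm_mul, RCLike.norm_ofReal, abs_of_nonneg hε]
    exact mul_le_of_le_one_right hε hc
  refine ⟨a, Ψ, ha, hΦa, ?_, ?_, fun x => ?_⟩
  · have hVn : U.idealNorm X V ≤
        Fintype.card (Finset (Fin N)) * K * U.idealNorm X Φ ^ 2 := by
      refine (Finset.le_sum_of_subadditive _ (map_zero _).le (map_add_le_add _) _ _).trans ?_
      rw [mul_assoc, ← nsmul_eq_mul]
      refine Finset.sum_le_card_nsmul _ _ _ fun j _ => (hV a j Φ).trans ?_
      exact mul_le_of_le_one_right (by positivity)
        (Finset.prod_le_one (fun _ _ => norm_nonneg _) fun i _ => ha i)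
    rw [show Ψ - Φ = ((ε : 𝕜) * c) • V from
      add_sub_cancel_left Φ (((ε : 𝕜) * c) • V), map_smul_eq_mul]
    exact mul_le_mul hεc hVn (apply_nonneg _ _) hε
  · refine le_trans (le_of_eq ?_) (Ψ.1.norm_apply_le_norm ha)
    have h1 : Ψ.1 a = Φ.1 a *
        ((1 + Fintype.card (Finset (Fin N)) * ε * ‖Φ.1 a‖ : ℝ) : 𝕜) := by
      rw [hΨx, hVx]
      simp only [Finset.piecewise_same, Finset.sum_const, nsmul_eq_mul, Finset.card_univ]
      push_cast
      linear_combination (ε : 𝕜) * Fintype.card (Finset (Fin N)) * Φ.1 a * hcΦ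
    rw [h1, norm_mul, RCLike.norm_ofReal, abs_of_nonneg (by positivity)]
    ring
  · rw [hΨx, hVx]
    refine (norm_add_le _ _).trans (add_le_add_right ?_ _)
    rw [norm_mul]
    refine mul_le_mul hεc ((norm_sum_le _ _).trans (le_of_eq ?_)) (norm_nonneg _) hε
    simp only [norm_mul]

theorem norm_sub_le_idealNorm (Φ Ψ : U.carrier X) : ‖Φ.1 - Ψ.1‖ ≤ U.idealNorm X (Φ - Ψ) :=
  U.norm_le_idealNorm (Φ - Ψ)

/-- Along Lindenstrauss' iteration the point `(a_{m₁}, …, a_{m_N})` almost norms `Φ_n` as soon as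
all the indices `m_i` are at least `n`. -/
theorem norm_sub_le_norm_apply_mixed {Φ : ℕ → U.carrier X} {a : ℕ → ∀ i, X i} {ε : ℕ → ℝ}
    {D : ℝ} (ha : ∀ n i, ‖a n i‖ ≤ 1) (hε : ∀ n, 0 < ε n)
    (hε' : ∀ n, ε (n + 1) = ε n ^ 3) (hanti : Antitone ε)
    (hD : ∀ n m, n ≤ m → U.idealNorm X (Φ m - Φ n) ≤ D * ε n)
    (hΦa : ∀ n, ‖(Φ n).1‖ - ε (n + 1) ≤ ‖(Φ n).1 (a n)‖)
    (hgrow : ∀ n, ‖(Φ n).1 (a n)‖ + Fintype.card (Finset (Fin N)) * ε n *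
      ‖(Φ n).1 (a n)‖ ^ 2 ≤ ‖(Φ (n + 1)).1‖)
    (hstep : ∀ n x, ‖(Φ (n + 1)).1 x‖ ≤ ‖(Φ n).1 x‖ + ε n * ∑ j : Finset (Fin N),
        ‖(Φ n).1 (j.piecewise x (a n))‖ * ‖(Φ n).1 (j.piecewise (a n) x)‖)
    (hsmall : ∀ n, 2 * Fintype.card (Finset (Fin N)) * ‖(Φ n).1‖ * ε n ^ 2 +
      (2 * D + 2) * ε n ≤ ‖(Φ n).1‖)
    (k : ℕ) : ∀ (n : ℕ) (m : Fin N → ℕ), (∀ i, n ≤ m i) →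
      (Finset.univ.filter fun i => n < m i).card ≤ k →
      ‖(Φ n).1‖ - ε n ≤ ‖(Φ n).1 fun i => a (m i) i‖ := by
  induction k with
  | zero =>
    intro n m hm hk
    have hk' : ∀ i, m i = n := fun i => by
      by_contra hne
      have : i ∈ Finset.univ.filter fun i => n < m i := by
        simpa using lt_of_le_of_ne (hm i) (Ne.symm hne)
      exact absurd (Finset.card_pos.2 ⟨i, this⟩) (by omega)
    have := hanti n.le_succ
    simp only [hk']
    exact (by linarith [hΦa n] : ‖(Φ n).1‖ - ε n ≤ ‖(Φ n).1 (a n)‖)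
  | succ k ih =>
    intro n m hm hk
    set j := Finset.univ.filter fun i => n < m i with hj
    by_cases hj0 : j.card ≤ k
    · exact ih n m hm hj0
    obtain ⟨i₀, hi₀, hmin⟩ := j.exists_min_image m (Finset.card_pos.1 (by omega))
    have hnn : n + 1 ≤ m i₀ := (Finset.mem_filter.1 hi₀).2
    -- Coordinates outside j will be overwritten by those of a_n, so they are free. Giving them the
    -- least late index m i₀ removes i₀ from the strictly later places, and the induction hypothesis
    -- applies at level m i₀.
    let m' : Fin N → ℕ := fun i => if i ∈ j then m i else m i₀
    have hm' : ∀ i, m i₀ ≤ m' i := fun i => by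
      by_cases hi : i ∈ j
      · simpa [m', hi] using hmin i hi
      · simp [m', hi]
    have hcard : (Finset.univ.filter fun i => m i₀ < m' i).card ≤ k := by
      have hsub : (Finset.univ.filter fun i => m i₀ < m' i) ⊆ j.erase i₀ := fun i hi => by
        have hi' := (Finset.mem_filter.1 hi).2
        by_cases hij : i ∈ j
        · refine Finset.mem_erase.2 ⟨?_, hij⟩
          rintro rfl
          simp [m'] at hi'
        · simp [m', hij] at hi'
      have := Finset.card_le_card hsub
      rw [Finset.card_erase_of_mem hi₀] at this
      omega
    let x : ∀ i, X i := fun i => a (m' i) i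
    have hx : ∀ i, ‖x i‖ ≤ 1 := fun i => ha _ i
    have hIH : ‖(Φ (m i₀)).1‖ - ε (m i₀) ≤ ‖(Φ (m i₀)).1 x‖ := ih (m i₀) m' hm' hcard
    have hpw : (fun i => a (m i) i) = j.piecewise x (a n) := by
      ext i
      by_cases hi : i ∈ j
      · simp [x, m', hi]
      · have : m i = n := le_antisymm (by simpa [hj] using hi) (hm i)
        simp [hi, this]
    have hdiff := (norm_sub_le_idealNorm (Φ (m i₀)) (Φ (n + 1))).trans (hD _ _ hnn)
    have hd1 : ‖(Φ (m i₀)).1 x‖ ≤ ‖(Φ (n + 1)).1 x‖ + D * ε (n + 1) := by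
      have h1 := ((Φ (m i₀)).1 - (Φ (n + 1)).1).norm_apply_le_norm hx
      have h2 := norm_sub_norm_le ((Φ (m i₀)).1 x) ((Φ (n + 1)).1 x)
      rw [sub_apply] at h1
      linarith
    have hd2 : ‖(Φ (n + 1)).1‖ - D * ε (n + 1) ≤ ‖(Φ (m i₀)).1‖ := by
      have := norm_sub_norm_le (Φ (n + 1)).1 (Φ (m i₀)).1
      rw [norm_sub_rev] at this
      linarith
    have hε2 : ε (m i₀) ≤ ε (n + 1) := hanti hnn
    have hpx : ∀ {y z : ∀ i, X i}, (∀ i, ‖y i‖ ≤ 1) → (∀ i, ‖z i‖ ≤ 1) →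
        ∀ j : Finset (Fin N), ‖(Φ n).1 (j.piecewise y z)‖ ≤ ‖(Φ n).1‖ := fun hy hz j =>
      (Φ n).1.norm_apply_le_norm fun i => by
        by_cases hi : i ∈ j
        · simpa [hi] using hy i
        · simpa [hi] using hz i
    -- In τ, D ε_{n+1} occurs twice, for passing from Φ_{m i₀} to Φ_{n+1} in the value and in the
    -- norm; the remaining ε_{n+1} is the induction error.
    have key := mixed_term_lower_bound (S := Finset.univ)
      (α := fun j : Finset (Fin N) => ‖(Φ n).1 (j.piecewise x (a n))‖)
      (β := fun j : Finset (Fin N) => ‖(Φ n).1 (j.piecewise (a n) x)‖)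
      (s := ‖(Φ n).1‖) (v := ‖(Φ n).1 (a n)‖) (η := ε (n + 1))
      (τ := (2 * D + 1) * ε (n + 1)) (ε := ε n)
      (fun _ => norm_nonneg _) (hpx hx (ha n)) (fun _ => norm_nonneg _) (hpx (ha n) hx)
      (norm_nonneg _) (hΦa n) ((Φ n).1.norm_apply_le_norm (ha n)) (hε n).le
      (by
        rw [Finset.card_univ]
        linarith [hgrow n, hstep n x, (Φ n).1.norm_apply_le_norm hx])
      (Finset.mem_univ j)
    rw [hpw]
    rw [Finset.card_univ, hε'] at key
    have hs : 0 < ‖(Φ n).1‖ := by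
      have hD0 : 0 ≤ D * ε n := (apply_nonneg _ _).trans (hD n n le_rfl)
      have h1 := hsmall n
      have h2 : 0 ≤ 2 * Fintype.card (Finset (Fin N)) * ‖(Φ n).1‖ * ε n ^ 2 := by
        have := hε n; positivity
      linarith [hε n]
    -- Dividing by ε_n ‖Φ_n‖ costs one power of ε_n; since ε_{n+1} = ε_n³, an error of order ε_n²
    -- remains, below ε_n by `hsmall`.
    have hfin : ε n * ‖(Φ n).1‖ * (‖(Φ n).1‖ - ‖(Φ n).1 (j.piecewise x (a n))‖) ≤
        ε n * ‖(Φ n).1‖ * ε n := by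
      have := mul_le_mul_of_nonneg_left (hsmall n) (sq_nonneg (ε n))
      calc _ ≤ _ := key
        _ = ε n ^ 2 * (2 * Fintype.card (Finset (Fin N)) * ‖(Φ n).1‖ * ε n ^ 2 +
            (2 * D + 2) * ε n) := by ring
        _ ≤ _ := this
        _ = _ := by ring
    have := le_of_mul_le_mul_left hfin (mul_pos (hε n) hs)
    linarith

/-- The multilinear Lindenstrauss theorem for stable ideals. -/
theorem StableAt.exists_arensExtensionsAttainNormTogether (hU : U.StableAt X) (Φ : U.carrier X)
    {δ : ℝ} (hδ : 0 < δ) : ∃ Ψ : U.carrier X,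
      ArensExtensionsAttainNormTogether Ψ.1 ∧ U.idealNorm X (Φ - Ψ) < δ := by
  -- The step sizes below are small relative to ‖Φ‖, so the zero form is treated apart.
  by_cases hΦ : ‖Φ.1‖ = 0
  · refine ⟨Φ, ⟨0, fun i => ?_, fun θ y'' hy => ?_⟩, by rw [sub_self Φ, map_zero]; exact hδ⟩
    · exact (norm_zero (E := StrongDual 𝕜 (StrongDual 𝕜 (X i)))).trans_le zero_le_one
    exact ((norm_arensExtension_le θ _ hy).trans hΦ.le).trans (norm_nonneg _)
  have hs : 0 < ‖Φ.1‖ := lt_of_le_of_ne (norm_nonneg _) (Ne.symm hΦ)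
  obtain ⟨K, hK, hU⟩ := hU
  set M : ℝ := (Fintype.card (Finset (Fin N)) : ℝ) with hM
  have hM0 : 0 ≤ M := Nat.cast_nonneg _
  -- A will bound the ideal norms of all iterates. The factor 2 in D turns ε_n into 2(ε_n - ε_{n+1})
  -- at most, so that the step bounds telescope.
  let A : ℝ := U.idealNorm X Φ + 1
  have hA : 0 ≤ U.idealNorm X Φ := apply_nonneg _ _
  let D : ℝ := 2 * (M * K * A ^ 2)
  have hD0 : 0 ≤ D := by positivity
  have hlim : ∀ c b : ℝ, 0 < b → ∀ᶠ t in 𝓝[>] (0 : ℝ), c * t < b := fun c b hb => by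
    have : Filter.Tendsto (fun t : ℝ => c * t) (𝓝[>] 0) (𝓝 (c * 0)) :=
      (Continuous.tendsto (by fun_prop) 0).mono_left nhdsWithin_le_nhds
    rw [mul_zero] at this
    exact this.eventually_lt_const hb
  -- In order: t < 1/2 for the cubic sequence, ideal norms at most A, sup norms at least ‖Φ‖/2,
  -- final distance below δ, and two bounds for `hsmall`.
  obtain ⟨t, ⟨⟨⟨⟨⟨h1, h2⟩, h3⟩, h4⟩, h5⟩, h6⟩, ht⟩ :=
    ((((((hlim 1 (1 / 2) (by norm_num)).and (hlim D 1 one_pos)).and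
      (hlim D (‖Φ.1‖ / 2) (by positivity))).and (hlim D δ hδ)).and
      (hlim (2 * M) (1 / 2) (by norm_num))).and
      (hlim (2 * D + 2) (‖Φ.1‖ / 4) (by positivity))).and self_mem_nhdsWithin |>.exists
  have ht : 0 < t := ht
  rw [one_mul] at h1
  obtain ⟨ε, hε0, hε⟩ := exists_cubic_sequence ht h1.le
  have hεpos := fun n => (hε n).1
  choose f g hf1 hf2 hf3 hf4 hf5 using fun (n : ℕ) (Θ : U.carrier X) =>
    exists_perturbation hK hU Θ (hεpos n).le (hεpos (n + 1))
  let Θ : ℕ → U.carrier X := fun n => Nat.rec Φ (fun n Θ => g n Θ) n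
  have hanti : Antitone ε := antitone_nat_of_succ_le fun n => by
    linarith [(hε n).2.2.2, hεpos n]
  have htri : ∀ x y z : U.carrier X,
      U.idealNorm X (x - z) ≤ U.idealNorm X (x - y) + U.idealNorm X (y - z) := fun x y z => by
    rw [← sub_add_sub_cancel x y z]; exact map_add_le_add _ _ _
  have hstepD : ∀ n, U.idealNorm X (Θ n) ≤ A →
      U.idealNorm X (Θ (n + 1) - Θ n) ≤ D * (ε n - ε (n + 1)) := fun n hn => by
    refine (hf3 n (Θ n)).trans ?_
    have h7 : U.idealNorm X (Θ n) ^ 2 ≤ A ^ 2 := pow_le_pow_left₀ (apply_nonneg _ _) hn 2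
    have h8 : M * K * U.idealNorm X (Θ n) ^ 2 ≤ M * K * A ^ 2 :=
      mul_le_mul_of_nonneg_left h7 (by positivity)
    calc _ ≤ ε n * (M * K * A ^ 2) := mul_le_mul_of_nonneg_left h8 (hεpos n).le
      _ = D * (ε n - ε n / 2) := by simp only [D]; ring
      _ ≤ _ := mul_le_mul_of_nonneg_left (by linarith [(hε n).2.2.2]) hD0
  -- The bounds are proved jointly: the step estimate needs the first, which follows from the
  -- second.
  have hbound : ∀ n, U.idealNorm X (Θ n) ≤ A ∧
      U.idealNorm X (Θ n - Φ) ≤ D * (ε 0 - ε n) := fun n => by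
    have hAn : ∀ n, U.idealNorm X (Θ n - Φ) ≤ D * (ε 0 - ε n) → U.idealNorm X (Θ n) ≤ A :=
      fun n hn => by
        have h7 := map_add_le_add (U.idealNorm X) (Θ n - Φ) Φ
        rw [sub_add_cancel (Θ n) Φ] at h7
        have := mul_nonneg hD0 (hεpos n).le
        have : D * (ε 0 - ε n) ≤ 1 := by rw [hε0]; linarith
        simp only [A]; linarith
    induction n with
    | zero =>
      have : U.idealNorm X (Θ 0 - Φ) ≤ D * (ε 0 - ε 0) := by
        rw [show Θ 0 - Φ = 0 from sub_self Φ]; simp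
      exact ⟨hAn 0 this, this⟩
    | succ n ih =>
      have : U.idealNorm X (Θ (n + 1) - Φ) ≤ D * (ε 0 - ε (n + 1)) := by
        linarith [htri (Θ (n + 1)) (Θ n) Φ, hstepD n ih.1, ih.2]
      exact ⟨hAn (n + 1) this, this⟩
  have hD : ∀ n m, n ≤ m → U.idealNorm X (Θ m - Θ n) ≤ D * ε n := fun n m hnm => by
    have : U.idealNorm X (Θ m - Θ n) ≤ D * (ε n - ε m) := by
      induction m, hnm using Nat.le_induction with
      | base => rw [sub_self (Θ n), map_zero, sub_self, mul_zero]
      | succ m _ ih => linarith [htri (Θ (m + 1)) (Θ m) (Θ n), hstepD m (hbound m).1]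
    linarith [mul_nonneg hD0 (hεpos m).le]
  have hεlim : Filter.Tendsto ε Filter.atTop (𝓝 0) := by
    have hgeo : ∀ n, ε n ≤ t * (1 / 2) ^ n := fun n => by
      induction n with
      | zero => simp [hε0]
      | succ n ih => rw [pow_succ]; linarith [(hε n).2.2.2]
    have : Filter.Tendsto (fun n : ℕ => t * (1 / 2 : ℝ) ^ n) Filter.atTop (𝓝 (t * 0)) :=
      (tendsto_pow_atTop_nhds_zero_of_lt_one (by norm_num) (by norm_num)).const_mul t
    rw [mul_zero] at this
    exact squeeze_zero (fun n => (hεpos n).le) hgeo this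
  obtain ⟨Ψ, hΨ⟩ := U.complete X Θ fun r hr => by
    have : Filter.Tendsto (fun n => D * ε n + D * ε n) Filter.atTop (𝓝 (D * 0 + D * 0)) :=
      (hεlim.const_mul D).add (hεlim.const_mul D)
    simp only [mul_zero, add_zero] at this
    obtain ⟨n₀, hn₀⟩ := (this.eventually_lt_const hr).exists
    refine ⟨n₀, fun m hm n hn => ?_⟩
    have := htri (Θ m) (Θ n₀) (Θ n)
    rw [map_sub_rev (U.idealNorm X) (Θ n₀) (Θ n)] at this
    linarith [hD n₀ m hm, hD n₀ n hn]
  have hΨD : ∀ n, U.idealNorm X (Θ n - Ψ) ≤ D * ε n := fun n => by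
    have : Filter.Tendsto (fun m => D * ε n + U.idealNorm X (Θ m - Ψ)) Filter.atTop
        (𝓝 (D * ε n + 0)) := hΨ.const_add _
    rw [add_zero] at this
    refine ge_of_tendsto this (Filter.eventually_atTop.2 ⟨n, fun m hm => ?_⟩)
    have := htri (Θ n) (Θ m) Ψ
    rw [map_sub_rev (U.idealNorm X) (Θ n) (Θ m)] at this
    linarith [hD n m hm]
  have hsn : ∀ n, ‖Φ.1‖ / 2 ≤ ‖(Θ n).1‖ := fun n => by
    have h7 := norm_sub_le_idealNorm (Θ n) Φ
    have h8 := norm_sub_norm_le Φ.1 (Θ n).1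
    rw [norm_sub_rev] at h8
    have h9 := hD 0 n n.zero_le
    rw [hε0] at h9
    have h9 : U.idealNorm X (Θ n - Φ) ≤ D * t := h9
    linarith
  have hmix := norm_sub_le_norm_apply_mixed (Φ := Θ) (a := fun n => f n (Θ n)) (D := D)
    (fun n => hf1 n _) hεpos (fun n => (hε n).2.2.1) hanti hD
    (fun n => hf2 n _) (fun n => hf4 n _) (fun n => hf5 n _)
    (fun n => by
      have hb := hsn n
      have h7 : M * ε n ^ 2 ≤ M * t :=
        mul_le_mul_of_nonneg_left (by nlinarith [hεpos n, (hε n).2.1]) hM0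
      have h8 : (2 * D + 2) * ε n ≤ (2 * D + 2) * t :=
        mul_le_mul_of_nonneg_left (hε n).2.1 (by positivity)
      have h9 : ‖(Θ n).1‖ * (2 * (M * ε n ^ 2)) ≤ ‖(Θ n).1‖ * (1 / 2) :=
        mul_le_mul_of_nonneg_left (by linarith) (norm_nonneg _)
      rw [← hM]
      linarith) N
  refine ⟨Ψ, ?_, (hΨD 0).trans_lt (by rwa [hε0])⟩
  refine arensExtensionsAttainNormTogether_of_sequence Ψ.1 (fun n => f n (Θ n))
    (fun n => hf1 n _) fun r hr => ?_
  -- The error ε_n comes from mixing, and D ε_n twice from replacing Θ_n by Ψ in the value and in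
  -- the norm.
  have hl : Filter.Tendsto (fun n => (2 * D + 1) * ε n) Filter.atTop (𝓝 ((2 * D + 1) * 0)) :=
    hεlim.const_mul _
  rw [mul_zero] at hl
  obtain ⟨n, hn⟩ := (hl.eventually_lt_const hr).exists
  refine ⟨n, fun m hm => ?_⟩
  have h7 := hmix n m hm ((Finset.card_le_univ _).trans_eq (Fintype.card_fin N))
  have h8 := (norm_sub_le_idealNorm (Θ n) Ψ).trans (hΨD n)
  have h9 := ((Θ n).1 - Ψ.1).norm_apply_le_norm (x := fun i => f (m i) (Θ (m i)) i)
    fun i => hf1 _ _ i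
  rw [sub_apply] at h9
  have h10 := norm_sub_norm_le ((Θ n).1 fun i => f (m i) (Θ (m i)) i)
    (Ψ.1 fun i => f (m i) (Θ (m i)) i)
  have h11 := norm_sub_norm_le Ψ.1 (Θ n).1
  rw [norm_sub_rev] at h11
  linarith

end BanachIdealOfForms

theorem mainTheorem5 (𝕜 : Type) [RCLike 𝕜] (U : BanachIdealOfForms.{u} 𝕜 3)
    (X : Fin 3 → Type u) [∀ i, NormedAddCommGroup (X i)] [∀ i, NormedSpace 𝕜 (X i)]
    [∀ i, CompleteSpace (X i)] :
    U.StableAt X ∧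
      ∀ Φ : U.carrier X, ∀ ε : ℝ, 0 < ε → ∃ Ψ : U.carrier X,
        ArensExtensionsAttainNormTogether Ψ.1 ∧ U.idealNorm X (Φ - Ψ) < ε :=
  ⟨U.stableAt_three X, fun Φ _ hε =>
    (U.stableAt_three X).exists_arensExtensionsAttainNormTogether Φ hε⟩
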